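/- Let $K$ be a field of characteristic $0$. A set $Z$ of $ab$ points of $\mathbb P^3=\mathbb P^3_K$ is an $(a,b)$-grid if there are $a$ pairwise skew lines $L_1,\dots,L_a$ and $b$ pairwise skew lines $L_1',\dots,L_b'$ in $\mathbb P^3$ such that $L_i$ and $L_j'$ are different and incident for all $i,j$, and $Z=\{L_i\cap L_j' : 1\le i\le a,\ 1\le j\le b\}$. For a set $V\subset\mathbb P^3$ let $I_V\subset R=K[x_0,x_1,x_2,x_3]$ be its homogeneous ideal, and write $[I]_d$ for the space of forms of degree $d$ in a homogeneous ideal $I$. A finite set $Z\subset\mathbb P^3$ not contained in a plane has the unexpected cone property $C(d)$, where $d\ge 1$, if for a general point $P\in\mathbb P^3$ (that is, for all $P$ in some nonempty Zariski open subset) there is an unexpected surface of degree $d$ and multiplicity $d$ at $P$ containing $Z$, meaning that $$\dim_K\,[I_Z\cap I_P^d]_d>\max\left\{0,\ \dim_K\,[I_Z]_d-\binom{d+2}{3}\right\}.$$ **Theorem.** Let $a,b$ be integers with $b\ge a\ge 2$ and $b\ge 3$. Then every $(a,b)$-grid $Z\subset\mathbb P^3$ satisfies $C(a)$. If moreover $a,b\ge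 3$, then $Z$ also satisfies $C(b)$. -/

import Mathlib

open MvPolynomial
open scoped LinearAlgebra.Projectivization

/-- Projective three-space over `K` (its `K`-points). -/
abbrev P3 (K : Type*) [Field K] : Type _ := ℙ K (Fin 4 → K)

/-- A line in `ℙ³`, given as a two-dimensional linear subspace of `K⁴`. Its points are the
`P : P3 K` with `P.submodule ≤ W`. Two lines are skew iff the subspaces meet only in `0`. -/
def IsLine {K : Type*} [Field K] (W : Submodule K (Fin 4 → K)) : Prop :=
  Module.finrank K W = 2

/-- `Z` is an `(a, b)`-grid: a set of `a * b` points for which there are `a` pairwise skew lines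
`L i` and `b` pairwise skew lines `M j`, where `L i` and `M j` are always different and incident,
such that `Z` is the set of the intersection points of `L i` and `M j`. -/
def IsGrid {K : Type*} [Field K] (a b : ℕ) (Z : Set (P3 K)) : Prop :=
  Z.Finite ∧ Z.ncard = a * b ∧
  ∃ (L : Fin a → Submodule K (Fin 4 → K)) (M : Fin b → Submodule K (Fin 4 → K)),
    (∀ i, IsLine (L i)) ∧ (∀ j, IsLine (M j)) ∧
    (∀ i i', i ≠ i' → L i ⊓ L i' = ⊥) ∧
    (∀ j j', j ≠ j' → M j ⊓ M j' = ⊥) ∧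
    (∀ i j, L i ≠ M j ∧ L i ⊓ M j ≠ ⊥) ∧
    Z = {P : P3 K | ∃ i j, P.submodule ≤ L i ∧ P.submodule ≤ M j}

/-- The set `Z` is not contained in any proper linear subspace of `ℙ³`. -/
def IsNondegenerate {K : Type*} [Field K] (Z : Set (P3 K)) : Prop :=
  ∀ W : Submodule K (Fin 4 → K), (∀ P ∈ Z, P.submodule ≤ W) → W = ⊤

/-- The ideal `I_Z` of a set `Z` of points of `ℙ³`: all polynomials in `K[x₀, x₁, x₂, x₃]` that
vanish at every homogeneous coordinate vector of every point of `Z`. (Over an infinite field this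
is the homogeneous ideal generated by the forms that vanish on `Z`.) -/
noncomputable def idealOf {K : Type*} [Field K] (Z : Set (P3 K)) :
    Ideal (MvPolynomial (Fin 4) K) :=
  vanishingIdeal K {v : Fin 4 → K | ∃ hv : v ≠ 0, Projectivization.mk K v hv ∈ Z}

/-- The graded piece `[I]_d`: the `K`-vector space of forms of degree `d` in `I`. -/
noncomputable def gradedPiece {K : Type*} [Field K] (I : Ideal (MvPolynomial (Fin 4) K)) (d : ℕ) :
    Submodule K (MvPolynomial (Fin 4) K) :=
  I.restrictScalars K ⊓ homogeneousSubmodule (Fin 4) K d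

/-- `dim_K [I]_d`; the space is finite dimensional, so `finrank` is the true dimension. -/
noncomputable def dimPiece {K : Type*} [Field K] (I : Ideal (MvPolynomial (Fin 4) K)) (d : ℕ) : ℕ :=
  Module.finrank K (gradedPiece I d)

/-- A property holds for a general point of `ℙ³`: it holds on the complement of some surface
`G = 0`, where `G` is a nonzero form. These complements are a basis of the nonempty Zariski open
sets. -/
def ForGeneralPoint {K : Type*} [Field K] (p : P3 K → Prop) : Prop :=
  ∃ (e : ℕ) (G : MvPolynomial (Fin 4) K), G.IsHomogeneous e ∧ G ≠ 0 ∧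
    ∀ (v : Fin 4 → K) (hv : v ≠ 0), eval v G ≠ 0 → p (Projectivization.mk K v hv)

/-- There is an unexpected surface of degree `d` and multiplicity `m` at `P` containing `Z`:
`dim [I_Z ∩ I_P^m]_d > max {0, dim [I_Z]_d - binom (m + 2) 3}`, the difference being taken in `ℤ`.
In particular `[I_Z ∩ I_P^m]_d` then contains a nonzero form. -/
def HasUnexpectedSurfaceAt {K : Type*} [Field K] (Z : Set (P3 K)) (d m : ℕ) (P : P3 K) : Prop :=
  max 0 ((dimPiece (idealOf Z) d : ℤ) - ((m + 2).choose 3 : ℤ)) <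
    (dimPiece (idealOf Z ⊓ idealOf {P} ^ m) d : ℤ)

/-- The unexpected cone property `C(d)` of a finite non-degenerate set of points of `ℙ³`. -/
def UnexpectedConeProperty {K : Type*} [Field K] (Z : Set (P3 K)) (d : ℕ) : Prop :=
  Z.Finite ∧ IsNondegenerate Z ∧ 0 < d ∧
    ForGeneralPoint (fun P : P3 K => HasUnexpectedSurfaceAt Z d d P)

/-! ### Dimensions of graded pieces -/

/-! Bound `[I_Z]_d` from above and the space of cones from below. If a point of the grid is fixed,
the planes spanned by one `L` and one `M` not through it miss it; products of `d` of them separate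
the points of a grid whose sides are at most `d + 1` (`exists_grid_separator`), so these points
impose independent conditions in degree `d`. For `C(a)` with `a < b`, an `a × (a + 1)` subgrid
already makes the expected dimension at most `0`, while the planes joining `P` to the `L i` form a
cone (`one_le_dimPiece_cone`). For `C(b)` with `a ≥ 3`, let `F` and `G` be the cones over the `L i`
and the `M j`. The multiples of `F` by cones of degree `b - a`, together with `G`, give dimension at
least `(b - a + 2).choose 2 + 1` (`choose_add_one_le_dimPiece_cone`), which exceeds `(b + 2).choose
2 - a * b`. -/

instance finiteDimensional_homogeneousSubmodule {K : Type*} [Field K] {σ : Type*} [Finite σ]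
    (d : ℕ) : FiniteDimensional K (homogeneousSubmodule σ K d) :=
  Module.Finite.iff_fg.2 (homogeneousSubmodule_fg σ K d)

lemma gradedPiece_le_homogeneousSubmodule {K : Type*} [Field K]
    (I : Ideal (MvPolynomial (Fin 4) K)) (d : ℕ) :
    gradedPiece I d ≤ homogeneousSubmodule (Fin 4) K d :=
  inf_le_right

instance finiteDimensional_gradedPiece {K : Type*} [Field K]
    (I : Ideal (MvPolynomial (Fin 4) K)) (d : ℕ) : FiniteDimensional K (gradedPiece I d) :=
  Submodule.finiteDimensional_of_le (gradedPiece_le_homogeneousSubmodule I d)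

lemma finrank_homogeneousSubmodule_fin {K : Type*} [Field K] (n d : ℕ) :
    Module.finrank K (homogeneousSubmodule (Fin (n + 1)) K d) = (d + n).choose n := by
  classical
  have e : {s : Fin (n + 1) →₀ ℕ | s.degree = d} ≃ Sym (Fin (n + 1)) d :=
    (Equiv.subtypeEquivRight fun _ => Iff.rfl).trans
      (Sym.equivNatSum (Fin (n + 1)) d).symm
  have : Fintype {s : Fin (n + 1) →₀ ℕ | s.degree = d} := Fintype.ofEquiv _ e.symm
  rw [homogeneousSubmodule_eq_finsupp_supported,
    (AddMonoidAlgebra.supportedEquivFinsupp _).finrank_eq, Module.finrank_finsupp_self,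
    Fintype.card_congr e, Sym.card_sym_fin_eq_multichoose, Nat.multichoose_eq,
    show n + 1 + d - 1 = d + n by omega, ← Nat.choose_symm_add]

/-- Points separated by forms of degree `d` impose independent conditions on forms of degree `d`. -/
lemma dimPiece_add_card_le {K : Type*} [Field K] {ι : Type*} [Fintype ι] [DecidableEq ι]
    (I : Ideal (MvPolynomial (Fin 4) K)) (d : ℕ) (p : ι → Fin 4 → K)
    (hI : ∀ f ∈ I, ∀ k, eval (p k) f = 0)
    (hs : ∀ k, ∃ s : MvPolynomial (Fin 4) K, s.IsHomogeneous d ∧ eval (p k) s ≠ 0 ∧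
      ∀ l, l ≠ k → eval (p l) s = 0) :
    dimPiece I d + Fintype.card ι ≤ (d + 3).choose 3 := by
  choose s hs1 hs2 hs3 using hs
  let ev : homogeneousSubmodule (Fin 4) K d →ₗ[K] (ι → K) :=
    (LinearMap.pi fun k => (aeval (R := K) (p k)).toLinearMap) ∘ₗ Submodule.subtype _
  have hev : ∀ f k, ev f k = eval (p k) (f : MvPolynomial (Fin 4) K) := fun f k => by
    simp [ev, aeval_eq_eval]
  -- Lagrange interpolation with the separators `s k`.
  have hsurj : Function.Surjective ev := by
    intro c
    refine ⟨∑ k, (c k / eval (p k) (s k)) • ⟨s k, hs1 k⟩, ?_⟩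
    ext l
    rw [map_sum, Finset.sum_apply, Finset.sum_eq_single l]
    · simp [hev, div_mul_cancel₀ _ (hs2 l)]
    · intro k _ hk
      simp [hev, hs3 k l hk.symm]
    · simp
  have h1 := ev.finrank_range_add_finrank_ker
  rw [LinearMap.range_eq_top.2 hsurj, finrank_top, Module.finrank_fintype_fun_eq_card,
    finrank_homogeneousSubmodule_fin] at h1
  have h2 : dimPiece I d ≤ Module.finrank K (LinearMap.ker ev) := by
    rw [← Submodule.finrank_map_subtype_eq]
    refine Submodule.finrank_mono fun f hf => ?_
    refine Submodule.mem_map.2 ⟨⟨f, gradedPiece_le_homogeneousSubmodule I d hf⟩, ?_, rfl⟩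
    rw [LinearMap.mem_ker]
    ext k
    exact (hev _ k).trans (hI f hf.1 k)
  omega

/-! ### Linear forms -/

/-- The linear form in `K[x₀, x₁, x₂, x₃]` attached to a functional on `K⁴`. -/
noncomputable def linForm {K : Type*} [Field K] (φ : Module.Dual K (Fin 4 → K)) :
    MvPolynomial (Fin 4) K :=
  ∑ i, C (φ (Pi.single i 1)) * X i

lemma eval_linForm {K : Type*} [Field K] (φ : Module.Dual K (Fin 4 → K)) (v : Fin 4 → K) :
    eval v (linForm φ) = φ v := by
  conv_rhs => rw [LinearMap.pi_apply_eq_sum_univ φ v]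
  simp only [linForm, map_sum, map_mul, eval_C, eval_X, smul_eq_mul]
  refine Finset.sum_congr rfl fun i _ => ?_
  rw [mul_comm]
  congr 2
  ext j
  simp [Pi.single_apply, eq_comm]

lemma isHomogeneous_linForm {K : Type*} [Field K] (φ : Module.Dual K (Fin 4 → K)) :
    (linForm φ).IsHomogeneous 1 := by
  refine IsHomogeneous.sum _ _ _ fun i _ => ?_
  simpa using (isHomogeneous_C (Fin 4) (φ (Pi.single i 1))).mul (isHomogeneous_X K i)

lemma linForm_ne_zero {K : Type*} [Field K] {φ : Module.Dual K (Fin 4 → K)} (h : φ ≠ 0) :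
    linForm φ ≠ 0 := by
  intro h0
  refine h (LinearMap.ext fun v => ?_)
  rw [← eval_linForm, h0]
  simp

lemma isHomogeneous_prod_linForm {K : Type*} [Field K] {n : ℕ}
    (φ : Fin n → Module.Dual K (Fin 4 → K)) : (∏ i, linForm (φ i)).IsHomogeneous n := by
  simpa using IsHomogeneous.prod Finset.univ _ _ fun i _ => isHomogeneous_linForm (φ i)

lemma mem_idealOf_singleton {K : Type*} [Field K] {φ : Module.Dual K (Fin 4 → K)}
    {v : Fin 4 → K} (hv : v ≠ 0) (h : φ v = 0) :
    linForm φ ∈ idealOf {Projectivization.mk K v hv} := by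
  rintro w ⟨hw, hw'⟩
  obtain ⟨c, hc⟩ := (Projectivization.mk_eq_mk_iff' K w v hw hv).1 hw'
  rw [aeval_eq_eval, eval_linForm, ← hc, map_smul, h, smul_zero]

lemma prod_linForm_mem_pow {K : Type*} [Field K] {n : ℕ} {φ : Fin n → Module.Dual K (Fin 4 → K)}
    {v : Fin 4 → K} (hv : v ≠ 0) (h : ∀ i, φ i v = 0) :
    ∏ i, linForm (φ i) ∈ idealOf {Projectivization.mk K v hv} ^ n := by
  simpa using Ideal.prod_mem_prod (s := Finset.univ)
    (I := fun _ : Fin n => idealOf {Projectivization.mk K v hv})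
    fun i _ => mem_idealOf_singleton hv (h i)

/-- Each monomial of `g` becomes a product of `n` elements of `I`. With `y` three linear forms
vanishing at `P`, this puts cones with vertex `P` in `I_P ^ n`. -/
lemma aeval_mem_pow_of_isHomogeneous {K A σ : Type*} [Field K] [CommRing A] [Algebra K A]
    [Fintype σ] {I : Ideal A} {y : σ → A} (hy : ∀ i, y i ∈ I) {n : ℕ} {g : MvPolynomial σ K}
    (hg : g.IsHomogeneous n) : aeval y g ∈ I ^ n := by
  rw [aeval_def, eval₂_eq']
  refine Ideal.sum_mem _ fun s hs => Ideal.mul_mem_left _ _ ?_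
  have hd : ∑ i, s i = n := by
    rw [← hg (mem_support_iff.1 hs), Finsupp.weight_apply, Finsupp.sum_fintype _ _ (by simp)]
    simp
  rw [← hd, ← Finset.prod_pow_eq_pow_sum]
  exact Ideal.prod_mem_prod fun i _ => Ideal.pow_mem_pow (hy i) _

/-! ### Planes spanned by the lines of a grid -/

lemma exists_dual_sup_span_le_ker {K : Type*} [Field K] {W : Submodule K (Fin 4 → K)}
    (hW : IsLine W) (v : Fin 4 → K) :
    ∃ φ : Module.Dual K (Fin 4 → K), φ ≠ 0 ∧ W ≤ LinearMap.ker φ ∧ φ v = 0 := by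
  have hlt : W ⊔ K ∙ v < ⊤ := by
    refine lt_top_iff_ne_top.2 fun h => ?_
    have h1 := Submodule.finrank_add_le_finrank_add_finrank W (K ∙ v)
    have h2 : Module.finrank K (K ∙ v) ≤ 1 := by simpa using finrank_span_le_card (R := K) {v}
    rw [h, finrank_top, Module.finrank_fin_fun, hW] at h1
    omega
  obtain ⟨φ, h0, hφ⟩ := Submodule.exists_le_ker_of_lt_top _ hlt
  exact ⟨φ, h0, le_sup_left.trans hφ,
    hφ (le_sup_right (a := W) (Submodule.mem_span_singleton_self v))⟩

lemma finrank_sup_le_three {K : Type*} [Field K] {W W' : Submodule K (Fin 4 → K)}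
    (hW : IsLine W) (hW' : IsLine W') (h : W ⊓ W' ≠ ⊥) : Module.finrank K ↥(W ⊔ W') ≤ 3 := by
  have h1 := Submodule.finrank_sup_add_finrank_inf_eq W W'
  have h2 := Submodule.one_le_finrank_iff.2 h
  rw [hW, hW'] at h1
  omega

lemma sup_eq_top_of_skew {K : Type*} [Field K] {W W' : Submodule K (Fin 4 → K)}
    (hW : IsLine W) (hW' : IsLine W') (h : W ⊓ W' = ⊥) : W ⊔ W' = ⊤ := by
  apply Submodule.eq_top_of_finrank_eq
  have h1 := Submodule.finrank_sup_add_finrank_inf_eq W W'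
  rw [hW, hW', h, finrank_bot] at h1
  rw [Module.finrank_fin_fun]
  omega

/-- A line meeting two skew lines in points of a subspace is contained in that subspace. -/
lemma line_le_of_inf_ne_bot {K : Type*} [Field K] {W X Y H : Submodule K (Fin 4 → K)}
    (hW : IsLine W) (hXY : X ⊓ Y = ⊥) {x y : Fin 4 → K} (hx0 : x ≠ 0) (hy0 : y ≠ 0)
    (hx : x ∈ X) (hy : y ∈ Y) (hxW : x ∈ W) (hyW : y ∈ W) (hxH : x ∈ H) (hyH : y ∈ H) :
    W ≤ H := by
  have hd : (K ∙ x) ⊓ (K ∙ y) = ⊥ := by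
    rw [eq_bot_iff, ← hXY]
    exact inf_le_inf ((Submodule.span_singleton_le_iff_mem _ _).2 hx)
      ((Submodule.span_singleton_le_iff_mem _ _).2 hy)
  have h1 := Submodule.finrank_sup_add_finrank_inf_eq (K ∙ x) (K ∙ y)
  rw [hd, finrank_bot, finrank_span_singleton hx0, finrank_span_singleton hy0] at h1
  have hle : (K ∙ x) ⊔ (K ∙ y) ≤ W := sup_le
    ((Submodule.span_singleton_le_iff_mem _ _).2 hxW)
    ((Submodule.span_singleton_le_iff_mem _ _).2 hyW)
  rw [← Submodule.eq_of_le_of_finrank_eq hle (by rw [hW]; omega)]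
  exact sup_le ((Submodule.span_singleton_le_iff_mem _ _).2 hxH)
    ((Submodule.span_singleton_le_iff_mem _ _).2 hyH)

lemma exists_surjective_of_card_le {α β : Type*} [Fintype α] [Fintype β] [Nonempty β]
    (h : Fintype.card β ≤ Fintype.card α) : ∃ u : α → β, Function.Surjective u := by
  obtain ⟨e⟩ := Function.Embedding.nonempty_of_card_le h
  exact ⟨Function.invFun e, Function.invFun_surjective e.injective⟩

/-- The points of a grid are separated by products of planes spanned by incident lines. -/
lemma exists_grid_separator {K : Type*} [Field K] {a b d : ℕ} (ha : 2 ≤ a) (hb : 2 ≤ b)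
    (had : a ≤ d + 1) (hbd : b ≤ d + 1)
    {L : Fin a → Submodule K (Fin 4 → K)} {M : Fin b → Submodule K (Fin 4 → K)}
    (hL : ∀ i, IsLine (L i)) (hM : ∀ j, IsLine (M j))
    (hLL : ∀ i i', i ≠ i' → L i ⊓ L i' = ⊥) (hMM : ∀ j j', j ≠ j' → M j ⊓ M j' = ⊥)
    {p : Fin a → Fin b → Fin 4 → K} (hp0 : ∀ i j, p i j ≠ 0) (hpL : ∀ i j, p i j ∈ L i)
    (hpM : ∀ i j, p i j ∈ M j) (i : Fin a) (j : Fin b) :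
    ∃ s : MvPolynomial (Fin 4) K, s.IsHomogeneous d ∧ eval (p i j) s ≠ 0 ∧
      ∀ i' j', (i', j') ≠ (i, j) → eval (p i' j') s = 0 := by
  have hplane : ∀ i' j', i' ≠ i → j' ≠ j → ∃ φ : Module.Dual K (Fin 4 → K),
      φ (p i j) ≠ 0 ∧ L i' ⊔ M j' ≤ LinearMap.ker φ := by
    intro i' j' hi hj
    have hnot : p i j ∉ L i' ⊔ M j' := by
      -- The plane would contain two points of `L i`, hence `L i` itself, besides the skew line `L
      -- i'`.
      intro hmem
      have h1 : L i ≤ L i' ⊔ M j' := line_le_of_inf_ne_bot (hL i) (hMM j j' hj.symm) (hp0 i j)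
        (hp0 i j') (hpM i j) (hpM i j') (hpL i j) (hpL i j') hmem
        (le_sup_right (a := L i') (hpM i j'))
      have h2 := Submodule.finrank_mono (sup_le h1 (le_sup_left (a := L i') (b := M j')))
      rw [sup_eq_top_of_skew (hL i) (hL i') (hLL i i' hi.symm), finrank_top,
        Module.finrank_fin_fun] at h2
      have h3 := finrank_sup_le_three (hL i') (hM j') fun h =>
        hp0 i' j' ((Submodule.mem_bot K).1 (h ▸ ⟨hpL i' j', hpM i' j'⟩))
      omega
    obtain ⟨φ, h1, h2⟩ := Submodule.exists_le_ker_of_notMem hnot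
    exact ⟨φ, h1, h2⟩
  choose φ hφ0 hφ using hplane
  have : Nontrivial (Fin a) := Fin.nontrivial_iff_two_le.2 ha
  have : Nontrivial (Fin b) := Fin.nontrivial_iff_two_le.2 hb
  have : Nonempty {i' // i' ≠ i} := nonempty_subtype.2 (exists_ne i)
  have : Nonempty {j' // j' ≠ j} := nonempty_subtype.2 (exists_ne j)
  -- The `d` planes must use every row other than `i` and every column other than `j`; repetitions
  -- bring the degree up to exactly `d`.
  obtain ⟨u, hu⟩ : ∃ u : Fin d → {i' // i' ≠ i}, Function.Surjective u :=
    exists_surjective_of_card_le (by simp; omega)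
  obtain ⟨w, hw⟩ : ∃ w : Fin d → {j' // j' ≠ j}, Function.Surjective w :=
    exists_surjective_of_card_le (by simp; omega)
  refine ⟨∏ k, linForm (φ (u k) (w k) (u k).2 (w k).2), isHomogeneous_prod_linForm _, ?_, ?_⟩
  · rw [map_prod, Finset.prod_ne_zero_iff]
    intro k _
    rw [eval_linForm]
    exact hφ0 _ _ _ _
  · intro i' j' hne
    rw [map_prod]
    by_cases hi : i' = i
    · have hj : j' ≠ j := fun hj => hne (by rw [hi, hj])
      obtain ⟨k, hk⟩ := hw ⟨j', hj⟩
      refine Finset.prod_eq_zero (Finset.mem_univ k) ?_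
      rw [eval_linForm]
      refine hφ _ _ _ _ (le_sup_right (a := L (u k)) ?_)
      rw [hk]
      exact hpM i' j'
    · obtain ⟨k, hk⟩ := hu ⟨i', hi⟩
      refine Finset.prod_eq_zero (Finset.mem_univ k) ?_
      rw [eval_linForm]
      refine hφ _ _ _ _ (le_sup_left (b := M (w k)) ?_)
      rw [hk]
      exact hpL i' j'

/-! ### The ideal of a grid -/

lemma eval_eq_zero_of_mem_idealOf {K : Type*} [Field K] {Z : Set (P3 K)}
    {f : MvPolynomial (Fin 4) K} (hf : f ∈ idealOf Z) {v : Fin 4 → K} (hv : v ≠ 0)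
    (h : Projectivization.mk K v hv ∈ Z) : eval v f = 0 := by
  simpa [aeval_eq_eval] using hf v ⟨hv, h⟩

lemma prod_linForm_mem_idealOf {K : Type*} [Field K] {Z : Set (P3 K)} {n : ℕ}
    {W : Fin n → Submodule K (Fin 4 → K)} (hZ : ∀ P ∈ Z, ∃ i, P.submodule ≤ W i)
    {φ : Fin n → Module.Dual K (Fin 4 → K)} (hφ : ∀ i, W i ≤ LinearMap.ker (φ i)) :
    ∏ i, linForm (φ i) ∈ idealOf Z := by
  rintro v ⟨hv, hvZ⟩
  obtain ⟨i, hi⟩ := hZ _ hvZ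
  rw [aeval_eq_eval, map_prod]
  refine Finset.prod_eq_zero (Finset.mem_univ i) ?_
  rw [eval_linForm]
  refine hφ i (hi ?_)
  rw [Projectivization.submodule_mk]
  exact Submodule.mem_span_singleton_self v

lemma dimPiece_idealOf_grid_add_le {K : Type*} [Field K] {a b d : ℕ} (ha : 2 ≤ a) (hb : 2 ≤ b)
    (had : a ≤ d + 1) (hbd : b ≤ d + 1)
    {L : Fin a → Submodule K (Fin 4 → K)} {M : Fin b → Submodule K (Fin 4 → K)}
    (hL : ∀ i, IsLine (L i)) (hM : ∀ j, IsLine (M j))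
    (hLL : ∀ i i', i ≠ i' → L i ⊓ L i' = ⊥) (hMM : ∀ j j', j ≠ j' → M j ⊓ M j' = ⊥)
    (hLM : ∀ i j, L i ⊓ M j ≠ ⊥) {Z : Set (P3 K)}
    (hZ : ∀ P : P3 K, ∀ i j, P.submodule ≤ L i → P.submodule ≤ M j → P ∈ Z) :
    dimPiece (idealOf Z) d + a * b ≤ (d + 3).choose 3 := by
  choose p hp hp0 using fun i j => Submodule.exists_mem_ne_zero_of_ne_bot (hLM i j)
  have key := dimPiece_add_card_le (idealOf Z) d (fun k : Fin a × Fin b => p k.1 k.2)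
    (fun f hf k => eval_eq_zero_of_mem_idealOf hf (hp0 k.1 k.2) (hZ _ k.1 k.2
      (by rw [Projectivization.submodule_mk, Submodule.span_singleton_le_iff_mem]
          exact (hp k.1 k.2).1)
      (by rw [Projectivization.submodule_mk, Submodule.span_singleton_le_iff_mem]
          exact (hp k.1 k.2).2)))
    (fun k => by
      obtain ⟨s, h1, h2, h3⟩ := exists_grid_separator ha hb had hbd hL hM hLL hMM hp0
        (fun i j => (hp i j).1) (fun i j => (hp i j).2) k.1 k.2
      exact ⟨s, h1, h2, fun l hl => h3 l.1 l.2 hl⟩)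
  simpa using key

/-- Two grid points on each `L i` force `L i ≤ W`, and two skew lines span `K⁴`. -/
lemma isNondegenerate_grid {K : Type*} [Field K] {a b : ℕ} (ha : 2 ≤ a) (hb : 2 ≤ b)
    {L : Fin a → Submodule K (Fin 4 → K)} {M : Fin b → Submodule K (Fin 4 → K)}
    (hL : ∀ i, IsLine (L i))
    (hLL : ∀ i i', i ≠ i' → L i ⊓ L i' = ⊥) (hMM : ∀ j j', j ≠ j' → M j ⊓ M j' = ⊥)
    (hLM : ∀ i j, L i ⊓ M j ≠ ⊥) {Z : Set (P3 K)}
    (hZ : ∀ P : P3 K, ∀ i j, P.submodule ≤ L i → P.submodule ≤ M j → P ∈ Z) :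
    IsNondegenerate Z := by
  intro W hW
  choose p hp hp0 using fun i j => Submodule.exists_mem_ne_zero_of_ne_bot (hLM i j)
  have hpW : ∀ i j, p i j ∈ W := by
    intro i j
    have := hW (Projectivization.mk K (p i j) (hp0 i j)) (hZ _ i j
      (by rw [Projectivization.submodule_mk, Submodule.span_singleton_le_iff_mem]
          exact (hp i j).1)
      (by rw [Projectivization.submodule_mk, Submodule.span_singleton_le_iff_mem]
          exact (hp i j).2))
    rwa [Projectivization.submodule_mk, Submodule.span_singleton_le_iff_mem] at this
  have hLW : ∀ i, L i ≤ W := fun i =>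
    line_le_of_inf_ne_bot (hL i) (hMM ⟨0, by omega⟩ ⟨1, by omega⟩ (by simp)) (hp0 _ _) (hp0 _ _)
      (hp i _).2 (hp i _).2 (hp i _).1 (hp i _).1 (hpW _ _) (hpW _ _)
  rw [eq_top_iff, ← sup_eq_top_of_skew (hL ⟨0, by omega⟩) (hL ⟨1, by omega⟩)
    (hLL _ _ (by simp))]
  exact sup_le (hLW _) (hLW _)

/-! ### Cones over a grid -/

lemma linForm_prod_ne_zero {K : Type*} [Field K] {n : ℕ}
    {φ : Fin n → Module.Dual K (Fin 4 → K)} (h : ∀ i, φ i ≠ 0) : ∏ i, linForm (φ i) ≠ 0 :=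
  Finset.prod_ne_zero_iff.2 fun i _ => linForm_ne_zero (h i)

/-- `T` is the projection from the point `v`; forms in its three coordinates are the cones with
vertex `v`. -/
lemma exists_surjective_apply_eq_zero {K : Type*} [Field K] {v : Fin 4 → K} (hv : v ≠ 0) :
    ∃ T : (Fin 4 → K) →ₗ[K] (Fin 3 → K), Function.Surjective T ∧ T v = 0 := by
  have h1 := Submodule.finrank_quotient_add_finrank (K ∙ v)
  rw [finrank_span_singleton hv, Module.finrank_fin_fun] at h1
  let e : ((Fin 4 → K) ⧸ (K ∙ v)) ≃ₗ[K] (Fin 3 → K) :=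
    LinearEquiv.ofFinrankEq _ _ (by rw [Module.finrank_fin_fun]; omega)
  refine ⟨e.toLinearMap ∘ₗ (K ∙ v).mkQ, e.surjective.comp (Submodule.mkQ_surjective _), ?_⟩
  simp

/-- The cone over a union of `n` lines covering `Z` is a form of degree `n`. -/
lemma one_le_dimPiece_cone {K : Type*} [Field K] {n : ℕ} {Z : Set (P3 K)}
    {L : Fin n → Submodule K (Fin 4 → K)} (hL : ∀ i, IsLine (L i))
    (hZ : ∀ P ∈ Z, ∃ i, P.submodule ≤ L i) (P : P3 K) :
    1 ≤ dimPiece (idealOf Z ⊓ idealOf {P} ^ n) n := by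
  induction P using Projectivization.ind with
  | h v hv =>
    choose φ h0 hφ hφv using fun i => exists_dual_sup_span_le_ker (hL i) v
    rw [dimPiece, Submodule.one_le_finrank_iff]
    refine (Submodule.ne_bot_iff _).2 ⟨∏ i, linForm (φ i), ⟨⟨?_, ?_⟩, ?_⟩,
      linForm_prod_ne_zero h0⟩
    · exact prod_linForm_mem_idealOf hZ hφ
    · exact prod_linForm_mem_pow hv hφv
    · exact isHomogeneous_prod_linForm φ

lemma exists_apply_eq_zero_forall_apply_ne_zero {K : Type*} [Field K] [Infinite K] {n : ℕ}
    {φ : Module.Dual K (Fin 4 → K)} {ψ : Fin n → Module.Dual K (Fin 4 → K)}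
    (h : ∀ j, ¬ LinearMap.ker φ ≤ LinearMap.ker (ψ j)) :
    ∃ x, φ x = 0 ∧ ∀ j, ψ j x ≠ 0 :=
  Module.Dual.exists_forall_mem_ne_zero_of_forall_exists (LinearMap.ker φ) ψ fun j => by
    simpa [SetLike.not_le_iff_exists] using h j

/-- If `Z` is covered by `a` lines and also by `b ≥ a` lines, the cones with vertex `P` containing
`Z` include the multiples of the cone over the first lines and the cone over the second ones. -/
lemma choose_add_one_le_dimPiece_cone {K : Type*} [Field K] [Infinite K] {a b : ℕ} (ha : 0 < a)
    (hab : a ≤ b) {Z : Set (P3 K)} {L : Fin a → Submodule K (Fin 4 → K)}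
    {M : Fin b → Submodule K (Fin 4 → K)} (hL : ∀ i, IsLine (L i)) (hM : ∀ j, IsLine (M j))
    (hLM : ∀ i j, L i ≠ M j) (hZL : ∀ P ∈ Z, ∃ i, P.submodule ≤ L i)
    (hZM : ∀ P ∈ Z, ∃ j, P.submodule ≤ M j) {v : Fin 4 → K} (hv : v ≠ 0)
    (hgen : ∀ j, v ∉ L ⟨0, ha⟩ ⊔ M j) :
    (b - a + 2).choose 2 + 1 ≤
      dimPiece (idealOf Z ⊓ idealOf {Projectivization.mk K v hv} ^ b) b := by
  choose φ hφ0 hφ hφv using fun i => exists_dual_sup_span_le_ker (hL i) v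
  choose ψ hψ0 hψ hψv using fun j => exists_dual_sup_span_le_ker (hM j) v
  -- Otherwise a single plane would contain `L ⟨0, ha⟩`, `M j` and `v`, against `hgen`.
  have hker : ∀ j, ¬ LinearMap.ker (φ ⟨0, ha⟩) ≤ LinearMap.ker (ψ j) := by
    intro j hj
    have h1 : L ⟨0, ha⟩ < L ⟨0, ha⟩ ⊔ M j := by
      refine lt_of_le_of_ne le_sup_left fun h => hLM ⟨0, ha⟩ j ?_
      refine (Submodule.eq_of_le_of_finrank_eq (sup_eq_left.1 h.symm) ?_).symm
      rw [hL, hM]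
    have h2 : L ⟨0, ha⟩ ⊔ M j < LinearMap.ker (ψ j) :=
      lt_of_le_of_ne (sup_le ((hφ _).trans hj) (hψ j)) fun h => hgen j (h ▸ hψv j)
    have h3 : LinearMap.ker (ψ j) < ⊤ :=
      lt_top_iff_ne_top.2 fun h => hψ0 j (LinearMap.ker_eq_top.1 h)
    have h4 := Submodule.finrank_lt_finrank_of_lt h1
    have h5 := Submodule.finrank_lt_finrank_of_lt h2
    have h6 := Submodule.finrank_lt_finrank_of_lt h3
    rw [finrank_top, Module.finrank_fin_fun] at h6
    rw [hL] at h4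
    omega
  -- At `x` the cone `F` vanishes and `G` does not, so `G` is not a multiple of `F`.
  obtain ⟨x, hx0, hx⟩ := exists_apply_eq_zero_forall_apply_ne_zero hker
  obtain ⟨T, hT, hTv⟩ := exists_surjective_apply_eq_zero hv
  set F := ∏ i, linForm (φ i) with hF
  set G := ∏ j, linForm (ψ j) with hG
  let y : Fin 3 → MvPolynomial (Fin 4) K := fun k => linForm (LinearMap.proj k ∘ₗ T)
  have hy : ∀ (w : Fin 4 → K) (g : MvPolynomial (Fin 3) K), eval w (aeval y g) = eval (T w) g := by
    intro w g
    rw [← aeval_eq_eval, ← AlgHom.comp_apply, comp_aeval, ← aeval_eq_eval]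
    congr 2
    ext k
    simp [y, aeval_eq_eval, eval_linForm]
  have hinj : ∀ g : MvPolynomial (Fin 3) K, aeval y g = 0 → g = 0 := by
    intro g hg
    refine MvPolynomial.funext fun u => ?_
    obtain ⟨w, rfl⟩ := hT u
    rw [← hy, hg, map_zero, map_zero]
  let Φ : (homogeneousSubmodule (Fin 3) K (b - a) × K) →ₗ[K] MvPolynomial (Fin 4) K :=
    (LinearMap.mulLeft K F ∘ₗ (aeval (R := K) y).toLinearMap ∘ₗ Submodule.subtype _).coprod
      (LinearMap.toSpanSingleton K _ G)
  have hΦ : ∀ g c, Φ (g, c) = F * aeval y (g : MvPolynomial (Fin 3) K) + c • G := fun g c => by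
    simp [Φ]
  have hmem : ∀ z, Φ z ∈ gradedPiece (idealOf Z ⊓ idealOf {Projectivization.mk K v hv} ^ b) b := by
    rintro ⟨g, c⟩
    have hba : a + (b - a) = b := by omega
    rw [hΦ]
    refine add_mem ⟨⟨?_, ?_⟩, ?_⟩ (Submodule.smul_mem _ _ ⟨⟨?_, ?_⟩, ?_⟩)
    · exact Ideal.mul_mem_right _ _ (prod_linForm_mem_idealOf hZL hφ)
    · have := Ideal.mul_mem_mul (prod_linForm_mem_pow hv hφv) (aeval_mem_pow_of_isHomogeneous
        (y := y)
        (fun k => mem_idealOf_singleton hv (by simp [hTv])) g.2)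
      rwa [← pow_add, hba] at this
    · have := (isHomogeneous_prod_linForm φ).mul
        (IsHomogeneous.aeval g.2 y (n := 1) fun k => isHomogeneous_linForm _)
      rwa [one_mul, hba] at this
    · exact prod_linForm_mem_idealOf hZM hψ
    · exact prod_linForm_mem_pow hv hψv
    · exact isHomogeneous_prod_linForm ψ
  have hΦinj : Function.Injective (LinearMap.codRestrict _ Φ hmem) := by
    rw [← LinearMap.ker_eq_bot, LinearMap.ker_codRestrict, LinearMap.ker_eq_bot']
    rintro ⟨g, c⟩ h
    rw [hΦ] at h
    have hFx : eval x F = 0 := by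
      rw [hF, map_prod]
      exact Finset.prod_eq_zero (Finset.mem_univ ⟨0, ha⟩) (by rw [eval_linForm, hx0])
    have hGx : eval x G ≠ 0 := by
      rw [hG, map_prod, Finset.prod_ne_zero_iff]
      intro j _
      rw [eval_linForm]
      exact hx j
    have hc : c = 0 := by
      have := congrArg (eval x) h
      simpa [hFx, smul_eval, hGx] using this
    subst hc
    rw [zero_smul, add_zero] at h
    have hg := hinj _ ((mul_eq_zero.1 h).resolve_left (linForm_prod_ne_zero hφ0))
    rw [Submodule.coe_eq_zero.1 hg]
    rfl
  have key := LinearMap.finrank_le_finrank_of_injective hΦinj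
  rwa [Module.finrank_prod, finrank_homogeneousSubmodule_fin, Module.finrank_self] at key

lemma exists_form_of_forall_ne_top {K : Type*} [Field K] {n : ℕ}
    {W : Fin n → Submodule K (Fin 4 → K)} (hW : ∀ j, W j ≠ ⊤) :
    ∃ G : MvPolynomial (Fin 4) K, G.IsHomogeneous n ∧ G ≠ 0 ∧
      ∀ v, eval v G ≠ 0 → ∀ j, v ∉ W j := by
  choose φ hφ0 hφ using fun j => Submodule.exists_le_ker_of_lt_top _ (lt_top_iff_ne_top.2 (hW j))
  refine ⟨_, isHomogeneous_prod_linForm φ, linForm_prod_ne_zero hφ0, fun v hv j hj => hv ?_⟩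
  rw [map_prod]
  exact Finset.prod_eq_zero (Finset.mem_univ j) (by rw [eval_linForm]; exact hφ j hj)

/-! ### Binomial estimates -/

lemma choose_three_succ (d : ℕ) :
    ((d + 3).choose 3 : ℤ) = (d + 2).choose 3 + (d + 2).choose 2 := by
  rw [Nat.choose_succ_succ' (d + 2) 2]
  push_cast
  ring

lemma two_mul_choose_two (d : ℕ) : 2 * ((d + 2).choose 2 : ℤ) = (d + 2) * (d + 1) := by
  have h' := Nat.add_one_mul_choose_eq (d + 1) 1
  simp only [Nat.choose_one_right] at h'
  have h'' : (((d + 1 + 1) * (d + 1) : ℕ) : ℤ) = ((d + 2).choose 2 * 2 : ℕ) := by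
    exact_mod_cast h'
  push_cast at h''
  linarith

/-! ### The cone properties of a grid -/

lemma unexpectedConeProperty_of_lt {K : Type*} [Field K] {a b : ℕ} (ha : 2 ≤ a) (hab : a < b)
    {Z : Set (P3 K)} (hZ : IsGrid a b Z) : UnexpectedConeProperty Z a := by
  obtain ⟨hfin, -, L, M, hL, hM, hLL, hMM, hLM, rfl⟩ := hZ
  refine ⟨hfin, isNondegenerate_grid ha (by omega) hL hLL hMM (fun i j => (hLM i j).2)
    -- The constant form `1` serves: here every `P` is general.
    fun P i j h1 h2 => ⟨i, j, h1, h2⟩, by omega, 0, 1, isHomogeneous_one _ _, one_ne_zero,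
    fun v hv _ => ?_⟩
  have h1 := one_le_dimPiece_cone (n := a) (Z := {P : P3 K | ∃ i j, P.submodule ≤ L i ∧
    P.submodule ≤ M j}) hL (fun P ⟨i, _, h, _⟩ => ⟨i, h⟩) (Projectivization.mk K v hv)
  -- Only `a + 1` of the lines `M j` are kept, as separation in degree `a` allows no more.
  have h2 := dimPiece_idealOf_grid_add_le (d := a) (b := a + 1) ha (by omega) (by omega) le_rfl hL
    (M := fun j => M (j.castLE hab)) (fun j => hM _) hLL
    (fun j j' h => hMM _ _ fun h' => h (Fin.castLE_injective _ h')) (fun i j => (hLM _ _).2)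
    (Z := {P : P3 K | ∃ i j, P.submodule ≤ L i ∧ P.submodule ≤ M j})
    fun P i j h1 h2 => ⟨i, _, h1, h2⟩
  have h3 := choose_three_succ a
  have h4 := two_mul_choose_two a
  beta_reduce
  unfold HasUnexpectedSurfaceAt
  zify at h1 h2
  -- Twice `a * (a + 1) - (a + 2).choose 2` is `(a + 1) * (a - 2) ≥ 0`.
  refine lt_of_le_of_lt (max_le le_rfl ?_) (zero_lt_one.trans_le h1)
  have ha' : (2 : ℤ) ≤ a := by exact_mod_cast ha
  nlinarith

lemma unexpectedConeProperty_of_three_le {K : Type*} [Field K] [CharZero K] {a b : ℕ} (ha : 3 ≤ a)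
    (hab : a ≤ b) {Z : Set (P3 K)} (hZ : IsGrid a b Z) : UnexpectedConeProperty Z b := by
  obtain ⟨hfin, -, L, M, hL, hM, hLL, hMM, hLM, rfl⟩ := hZ
  have : Infinite K := Infinite.of_injective _ (Nat.cast_injective (R := K))
  have hW : ∀ j, L ⟨0, by omega⟩ ⊔ M j ≠ ⊤ := by
    intro j h
    have := finrank_sup_le_three (hL _) (hM j) (hLM ⟨0, by omega⟩ j).2
    rw [h, finrank_top, Module.finrank_fin_fun] at this
    omega
  obtain ⟨G, hG, hG0, hGv⟩ := exists_form_of_forall_ne_top hW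
  refine ⟨hfin, isNondegenerate_grid (by omega) (by omega) hL hLL hMM (fun i j => (hLM i j).2)
    fun P i j h1 h2 => ⟨i, j, h1, h2⟩, by omega, b, G, hG, hG0, fun v hv hvG => ?_⟩
  have h1 := choose_add_one_le_dimPiece_cone (a := a) (Z := {P : P3 K | ∃ i j,
    P.submodule ≤ L i ∧ P.submodule ≤ M j}) (by omega) hab hL hM (fun i j => (hLM i j).1)
    (fun P ⟨i, _, h, _⟩ => ⟨i, h⟩) (fun P ⟨_, j, _, h⟩ => ⟨j, h⟩) hv (hGv v hvG)
  have h2 := dimPiece_idealOf_grid_add_le (d := b) (by omega) (by omega) (by omega) (by omega) hL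
    hM hLL hMM (fun i j => (hLM _ _).2)
    (Z := {P : P3 K | ∃ i j, P.submodule ≤ L i ∧ P.submodule ≤ M j})
    fun P i j h1 h2 => ⟨i, _, h1, h2⟩
  have h3 := choose_three_succ b
  have h4 := two_mul_choose_two b
  have h5 := two_mul_choose_two (b - a)
  rw [Nat.cast_sub hab] at h5
  beta_reduce
  unfold HasUnexpectedSurfaceAt
  zify at h1 h2
  have ha' : (3 : ℤ) ≤ a := by exact_mod_cast ha
  -- The actual lower bound exceeds the expected upper bound by `(a - 1) * (a - 2) / 2`, positive
  -- since `a ≥ 3`.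
  exact max_lt (lt_of_lt_of_le (by positivity) h1) (by nlinarith)

theorem theorem3p3 {K : Type*} [Field K] [CharZero K] (a b : ℕ) (ha : 2 ≤ a) (hab : a ≤ b)
    (hb : 3 ≤ b) (Z : Set (P3 K)) (hZ : IsGrid a b Z) :
    UnexpectedConeProperty Z a ∧ (3 ≤ a → 3 ≤ b → UnexpectedConeProperty Z b) := by
  refine ⟨?_, fun ha' _ => unexpectedConeProperty_of_three_le ha' hab hZ⟩
  -- When `a = b` there is no `(a + 1)`-st line, but `a ≥ 3` and `C(a)` is `C(b)`.
  rcases hab.lt_or_eq with h | rfl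
  · exact unexpectedConeProperty_of_lt ha h hZ
  · exact unexpectedConeProperty_of_three_le hb le_rfl hZ
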